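/- Let $A$ be a (not necessarily unital) $C^*$-algebra and $E$ a Hilbert $C^*$-module over $A$. Let $L(E)$ be the algebra of bounded adjointable operators on $E$, and $K(E)\subseteq L(E)$ the compact operators, i.e. the operator-norm closure of the linear span of the operators $\theta_{x,y}\colon z\mapsto x\langle y,z\rangle$, $x,y\in E$. A closed, densely defined $A$-linear operator $t\colon D(t)\subseteq E\to E$ whose adjoint $t^*$ is densely defined is called regular if $1+t^*t$ has dense range. A regular operator $t$ is called Fredholm if it has a pseudo left inverse and a pseudo right inverse, i.e. if there are $G,G'\in L(E)$ such that $Gt$ and $tG'$ (with their natural domains) are closable and their closures belong to $L(E)$ and satisfy $\overline{Gt}-1\in K(E)$ and $\overline{tG'}-1\in K(E)$. **Proposition.** If $t$ is a regular Fredholm operator on $E$ and $K\in K(E)$, then $t+K$, with domain $D(t)$, is a regular Fredholm operator on $E$. -/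

import Mathlib

/-! Operators on a Hilbert C*-module `E` over a (not necessarily unital) C*-algebra `A`.
Mathlib's `CStarModule A E` has an `A`-valued inner product that is linear in its second variable,
`⟪x, a • y⟫ = a * ⟪x, y⟫`; completeness of `E` is a separate hypothesis. -/

namespace HilbertModule

set_option linter.unusedSectionVars false

variable (A : Type*) {E : Type*} [NonUnitalCStarAlgebra A] [PartialOrder A] [StarOrderedRing A]
  [NormedAddCommGroup E] [NormedSpace ℂ E] [SMul A E] [CStarModule A E]

/-- Two vectors with the same inner products against all vectors are equal. -/
theorem ext_inner_left {x y : E} (h : ∀ w : E, inner A w x = inner A w y) : x = y := by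
  have h0 : inner A (x - y) (x - y) = 0 := by
    rw [CStarModule.inner_sub_right, h (x - y), sub_self]
  exact sub_eq_zero.mp (CStarModule.inner_self.mp h0)

variable {A} in
theorem norm_smul_le' (a : A) (x : E) : ‖a • x‖ ≤ ‖a‖ * ‖x‖ := by
  have h : ‖a • x‖ ^ 2 ≤ (‖a‖ * ‖x‖) ^ 2 := by
    rw [CStarModule.norm_sq_eq (A := A), CStarModule.inner_op_smul_left,
      CStarModule.inner_op_smul_right, mul_pow, CStarModule.norm_sq_eq (A := A) (x := x)]
    calc ‖a * inner A x x * star a‖ ≤ ‖a‖ * ‖inner A x x‖ * ‖star a‖ :=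
          (norm_mul_le _ _).trans (by gcongr; exact norm_mul_le _ _)
      _ = ‖a‖ ^ 2 * ‖inner A x x‖ := by rw [norm_star]; ring
  exact le_of_sq_le_sq h (by positivity)

/-- The elementary operator `θ_{x,y} : z ↦ ⟪y, z⟫ • x`. -/
noncomputable def rankOne (x y : E) : E →L[ℂ] E :=
  LinearMap.mkContinuous
    { toFun := fun z => inner A y z • x
      map_add' := fun z w => ext_inner_left A fun v => by
        simp [add_mul]
      map_smul' := fun c z => ext_inner_left A fun v => by
        simp [smul_mul_assoc] }
    (‖x‖ * ‖y‖) fun z => by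
      calc ‖inner A y z • x‖ ≤ ‖inner A y z‖ * ‖x‖ := norm_smul_le' _ _
        _ ≤ (‖y‖ * ‖z‖) * ‖x‖ := by gcongr; exact CStarModule.norm_inner_le E
        _ = ‖x‖ * ‖y‖ * ‖z‖ := by ring

@[simp]
theorem rankOne_apply (x y z : E) : rankOne A x y z = inner A y z • x := rfl

variable (E) in
/-- The compact operators `K(E)`: the operator-norm closure of the linear span of the `θ_{x,y}`. -/
noncomputable def compactOperators : Submodule ℂ (E →L[ℂ] E) :=
  (Submodule.span ℂ {T : E →L[ℂ] E | ∃ x y : E, T = rankOne A x y}).topologicalClosure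

/-- `T ∈ L(E)`: the bounded operator `T` has an adjoint on `E`. -/
def IsAdjointable (T : E →L[ℂ] E) : Prop :=
  ∃ S : E →L[ℂ] E, ∀ x y : E, inner A (T x) y = inner A x (S y)

/-- The pairs `(y, z)` such that `⟪t x, y⟫ = ⟪x, z⟫` for all `x ∈ D(t)`. -/
def adjointGraph (t : E →ₗ.[ℂ] E) : Submodule ℂ (E × E) where
  carrier := {p | ∀ x : t.domain, inner A (t x) p.1 = inner A (x : E) p.2}
  zero_mem' := fun x => by simp
  add_mem' := fun {p q} hp hq x => by
    simp only [Set.mem_ofPred_eq] at hp hq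
    simp [hp x, hq x]
  smul_mem' := fun c p hp x => by
    simp only [Set.mem_ofPred_eq] at hp
    simp [hp x]

/-- The adjoint `t*`; it is single-valued when `D(t)` is dense, see `graph_adjoint`. -/
noncomputable def adjoint (t : E →ₗ.[ℂ] E) : E →ₗ.[ℂ] E :=
  (adjointGraph A t).toLinearPMap

theorem graph_adjoint (t : E →ₗ.[ℂ] E) (ht : Dense (t.domain : Set E)) :
    (adjoint A t).graph = adjointGraph A t := by
  refine Submodule.toLinearPMap_graph_eq _ ?_
  rintro ⟨y, z⟩ h (rfl : y = 0)
  have hcont : Continuous fun x : E => inner A x z :=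
    (CStarModule.continuous_inner (A := A) (E := E)).comp (continuous_id.prodMk continuous_const)
  have hz : ∀ x : E, inner A x z = 0 := by
    intro x
    refine congrFun (Continuous.ext_on ht hcont continuous_const ?_) x
    intro v hv
    have := h ⟨v, hv⟩
    simpa using this.symm
  exact CStarModule.inner_self.mp (hz z)

section comp

variable {F : Type*} [AddCommGroup F] [Module ℂ F]

/-- The composition `g f` with its natural domain `{x ∈ D(f) | f x ∈ D(g)}`. -/
def comp (g f : F →ₗ.[ℂ] F) : F →ₗ.[ℂ] F where
  domain := (g.domain.comap f.toFun).map f.domain.subtype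
  toFun :=
    { toFun := fun x => g ⟨f ⟨x, (Submodule.map_subtype_le _ _) x.2⟩, by
        obtain ⟨y, hy, hyx⟩ := x.2
        have : (⟨x, (Submodule.map_subtype_le _ _) x.2⟩ : f.domain) = y := Subtype.ext hyx.symm
        rw [this]
        exact hy⟩
      map_add' := fun x y => by
        rw [← LinearPMap.map_add]
        congr 1
        exact Subtype.ext (LinearPMap.map_add f ⟨x, (Submodule.map_subtype_le _ _) x.2⟩
          ⟨y, (Submodule.map_subtype_le _ _) y.2⟩)
      map_smul' := fun c x => by
        rw [RingHom.id_apply, ← LinearPMap.map_smul]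
        congr 1
        exact Subtype.ext (LinearPMap.map_smul f c ⟨x, (Submodule.map_subtype_le _ _) x.2⟩) }

theorem mem_graph_comp (g f : F →ₗ.[ℂ] F) (p : F × F) :
    p ∈ (comp g f).graph ↔ ∃ y : F, (p.1, y) ∈ f.graph ∧ (y, p.2) ∈ g.graph := by
  obtain ⟨a, b⟩ := p
  simp only [LinearPMap.mem_graph_iff]
  constructor
  · rintro ⟨x, rfl, rfl⟩
    exact ⟨_, ⟨⟨x, (Submodule.map_subtype_le _ _) x.2⟩, rfl, rfl⟩, ⟨_, rfl, rfl⟩⟩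
  · rintro ⟨y, ⟨u, rfl, rfl⟩, ⟨v, hv, rfl⟩⟩
    have hu : f u ∈ g.domain := hv ▸ v.2
    refine ⟨⟨u, ⟨u, hu, rfl⟩⟩, rfl, ?_⟩
    change g _ = g _
    congr 1
    exact Subtype.ext hv.symm

end comp

/-- A regular operator on `E`: an `A`-linear, closed, densely defined operator `t` (defined on an
`A`-submodule) whose adjoint is densely defined and such that `1 + t* t` has dense range. -/
structure IsRegular (t : E →ₗ.[ℂ] E) : Prop where
  smul_mem : ∀ (a : A) (x : E), x ∈ t.domain → a • x ∈ t.domain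
  map_smul : ∀ (a : A) (x : t.domain), t ⟨a • (x : E), smul_mem a x x.2⟩ = a • t x
  isClosed : t.IsClosed
  dense_domain : Dense (t.domain : Set E)
  dense_adjoint_domain : Dense ((adjoint A t).domain : Set E)
  dense_range : Dense (Set.range ((LinearMap.id : E →ₗ[ℂ] E) +ᵥ comp (adjoint A t) t))

/-- `t` is closable, its closure is an (everywhere defined) operator in `L(E)`, and this operator
is congruent to `1` modulo `K(E)`. -/
def ClosureIsOneModCompact (t : E →ₗ.[ℂ] E) : Prop :=
  t.IsClosable ∧ ∃ T : E →L[ℂ] E, IsAdjointable A T ∧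
    t.closure = (T : E →ₗ[ℂ] E).toPMap ⊤ ∧ T - 1 ∈ compactOperators A E

/-- `G ∈ L(E)` is a pseudo left inverse of `t`: the closure of `G t` is in `1 + K(E)`. -/
def IsPseudoLeftInverse (G : E →L[ℂ] E) (t : E →ₗ.[ℂ] E) : Prop :=
  IsAdjointable A G ∧ ClosureIsOneModCompact A (comp ((G : E →ₗ[ℂ] E).toPMap ⊤) t)

/-- `G ∈ L(E)` is a pseudo right inverse of `t`: the closure of `t G` is in `1 + K(E)`. -/
def IsPseudoRightInverse (G : E →L[ℂ] E) (t : E →ₗ.[ℂ] E) : Prop :=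
  IsAdjointable A G ∧ ClosureIsOneModCompact A (comp t ((G : E →ₗ[ℂ] E).toPMap ⊤))

/-- A regular operator is Fredholm if it has a pseudo left inverse and a pseudo right inverse.
Regularity (`IsRegular A t`) is stated separately. -/
structure IsFredholm (t : E →ₗ.[ℂ] E) : Prop where
  exists_left : ∃ G : E →L[ℂ] E, IsPseudoLeftInverse A G t
  exists_right : ∃ G : E →L[ℂ] E, IsPseudoRightInverse A G t

end HilbertModule

namespace HilbertModule

set_option linter.unusedSectionVars false

section

variable {A E : Type*} [NonUnitalCStarAlgebra A] [PartialOrder A] [StarOrderedRing A]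
  [NormedAddCommGroup E] [NormedSpace ℂ E] [SMul A E] [CStarModule A E]

/-! Regularity survives any bounded adjointable perturbation. For `t` regular, the operator matrix
with rows `(1, t*)` and `(t, -1)`, viewed as the map `sumDiff` on `graph t × graph t*`, is bijective
onto `E × E`. It is bounded below because the cross terms of the inner products cancel
(`norm_le_norm_sumDiff`), so its range is closed, and regularity makes the range dense
(`IsRegular.graphComplemented`). Adding `K` to `t` adds a bounded term to the matrix. A Neumann
series handles `‖K‖ ≤ 1/4`; since the lower bound is the same for every operator, a general `K` is
reached in finitely many small steps (`GraphComplemented.vadd`). Surjectivity for `t + K` then gives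
back the dense range.

Compact operators are adjointable, so this covers `K ∈ K(E)`. For the Fredholm property the same
`G`, `G'` work: `G(t + K) = Gt + GK` and `(t + K)G' = tG' + KG'`, where `GK` and `KG'` are compact,
and closures commute with bounded perturbations (`topologicalClosure_graph_vadd`). -/

/-- A continuous linear map that is bounded below on a complete submodule has closed image. -/
theorem isClosed_map_of_bound {V W : Type*} [NormedAddCommGroup V] [NormedSpace ℂ V]
    [CompleteSpace V] [NormedAddCommGroup W] [NormedSpace ℂ W] (M : Submodule ℂ V)
    (hM : IsClosed (M : Set V)) (Φ : V →L[ℂ] W) (C : NNReal) (h : ∀ m ∈ M, ‖m‖ ≤ C * ‖Φ m‖) :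
    IsClosed (M.map (Φ : V →ₗ[ℂ] W) : Set W) := by
  have : CompleteSpace M := hM.completeSpace_coe
  have hanti : AntilipschitzWith C (Φ.comp M.subtypeL) :=
    ContinuousLinearMap.antilipschitz_of_bound _ fun m => h m m.2
  have := hanti.isClosed_range (Φ.comp M.subtypeL).uniformContinuous
  convert this using 1
  ext w
  simp

/-! ### Adjointable and compact bounded operators. -/

/-- The two operators are adjoint to each other. -/
def IsAdjointPair (A : Type*) [NonUnitalCStarAlgebra A] [PartialOrder A] [StarOrderedRing A]
    [SMul A E] [CStarModule A E] (T S : E →L[ℂ] E) : Prop :=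
  ∀ x y : E, inner A (T x) y = inner A x (S y)

theorem IsAdjointPair.symm {T S : E →L[ℂ] E} (h : IsAdjointPair A T S) : IsAdjointPair A S T :=
  fun x y => by rw [← CStarModule.star_inner (A := A) y (S x), ← h y x, CStarModule.star_inner]

theorem IsAdjointPair.norm_le {T S : E →L[ℂ] E} (h : IsAdjointPair A T S) : ‖S‖ ≤ ‖T‖ := by
  refine S.opNorm_le_bound (norm_nonneg _) fun y => ?_
  have h1 : ‖S y‖ ^ 2 ≤ ‖T‖ * ‖y‖ * ‖S y‖ := by
    rw [CStarModule.norm_sq_eq (A := A), ← h]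
    calc _ ≤ ‖T (S y)‖ * ‖y‖ := CStarModule.norm_inner_le E
      _ ≤ ‖T‖ * ‖S y‖ * ‖y‖ := by gcongr; exact T.le_opNorm _
      _ = _ := by ring
  rcases (norm_nonneg (S y)).eq_or_lt with h0 | h0
  · rw [← h0]; positivity
  · rw [pow_two] at h1
    exact le_of_mul_le_mul_right h1 h0

theorem IsAdjointPair.smul {T S : E →L[ℂ] E} (h : IsAdjointPair A T S) (c : ℂ) :
    IsAdjointPair A (c • T) (star c • S) := fun x y => by
  simp [CStarModule.inner_smul_left_complex, CStarModule.inner_smul_right_complex, h x y]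

theorem IsAdjointPair.add {T S T' S' : E →L[ℂ] E} (h : IsAdjointPair A T S)
    (h' : IsAdjointPair A T' S') : IsAdjointPair A (T + T') (S + S') := fun x y => by
  simp [h x y, h' x y]

/-- `A`-linearity is automatic for an operator with an adjoint: move it across the inner product. -/
theorem IsAdjointPair.map_smul {T S : E →L[ℂ] E} (h : IsAdjointPair A T S) (a : A) (x : E) :
    T (a • x) = a • T x :=
  ext_inner_left A fun w => by
    rw [← h.symm, CStarModule.inner_op_smul_right, CStarModule.inner_op_smul_right, h.symm]

variable (A E) in
/-- The bounded adjointable operators `L(E)` as a subspace of all bounded operators. -/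
def adjointableOperators : Submodule ℂ (E →L[ℂ] E) where
  carrier := {T | IsAdjointable A T}
  zero_mem' := ⟨0, fun x y => by simp⟩
  add_mem' := by
    rintro T T' ⟨S, h⟩ ⟨S', h'⟩
    exact ⟨S + S', IsAdjointPair.add h h'⟩
  smul_mem' := by
    rintro c T ⟨S, h⟩
    exact ⟨star c • S, IsAdjointPair.smul h c⟩

/-- By `IsAdjointPair.norm_le` the adjoints of a convergent sequence are Cauchy, and their limit is
an adjoint of the limit. -/
theorem isClosed_adjointableOperators [CompleteSpace E] :
    IsClosed (adjointableOperators A E : Set (E →L[ℂ] E)) := by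
  have hcont (x y : E) : Continuous fun p : (E →L[ℂ] E) × (E →L[ℂ] E) =>
      inner A (p.1 x) y - inner A x (p.2 y) := by
    have h1 : Continuous fun p : (E →L[ℂ] E) × (E →L[ℂ] E) => inner A (p.1 x) y :=
      (CStarModule.continuous_inner (A := A) (E := E)).comp
        (f := fun p : (E →L[ℂ] E) × (E →L[ℂ] E) => (p.1 x, y)) (by fun_prop)
    have h2 : Continuous fun p : (E →L[ℂ] E) × (E →L[ℂ] E) => inner A x (p.2 y) :=
      (CStarModule.continuous_inner (A := A) (E := E)).comp
        (f := fun p : (E →L[ℂ] E) × (E →L[ℂ] E) => (x, p.2 y)) (by fun_prop)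
    exact h1.sub h2
  let Z : Set ((E →L[ℂ] E) × (E →L[ℂ] E)) := {p | IsAdjointPair A p.1 p.2}
  have hZ : IsClosed Z := by
    have : Z = ⋂ x : E, ⋂ y : E, {p | inner A (p.1 x) y - inner A x (p.2 y) = 0} := by
      ext p
      simp [Z, IsAdjointPair, sub_eq_zero]
    rw [this]
    exact isClosed_iInter fun x => isClosed_iInter fun y =>
      isClosed_eq (hcont x y) continuous_const
  rw [← isSeqClosed_iff_isClosed]
  intro T L hT hL
  choose S hS using fun n => (hT n : IsAdjointable A (T n))
  have hS' : CauchySeq S := by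
    have hT' := hL.cauchySeq
    rw [Metric.cauchySeq_iff] at hT' ⊢
    intro ε hε
    obtain ⟨N, hN⟩ := hT' ε hε
    refine ⟨N, fun m hm n hn => ?_⟩
    have hsub : IsAdjointPair A (T m - T n) (S m - S n) := fun x y => by
      simp [hS m x y, hS n x y]
    have := hN m hm n hn
    rw [dist_eq_norm] at this ⊢
    exact hsub.norm_le.trans_lt this
  obtain ⟨L', hL'⟩ := cauchySeq_tendsto_of_complete hS'
  exact ⟨L', hZ.mem_of_tendsto (hL.prodMk_nhds hL') (.of_forall hS)⟩

theorem isAdjointPair_rankOne (x y : E) : IsAdjointPair A (rankOne A x y) (rankOne A y x) :=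
  fun z w => by
    rw [rankOne_apply, rankOne_apply, CStarModule.inner_op_smul_left,
      CStarModule.inner_op_smul_right, CStarModule.star_inner]

theorem isAdjointable_of_mem_compactOperators [CompleteSpace E] {K : E →L[ℂ] E}
    (hK : K ∈ compactOperators A E) : IsAdjointable A K := by
  have h : compactOperators A E ≤ adjointableOperators A E :=
    Submodule.topologicalClosure_minimal _ (Submodule.span_le.mpr <| by
      rintro _ ⟨x, y, rfl⟩
      exact ⟨_, isAdjointPair_rankOne x y⟩) isClosed_adjointableOperators
  exact h hK

/-- A continuous linear endomorphism of the bounded operators that preserves elementary operators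
preserves compact operators. -/
theorem map_mem_compactOperators (L : (E →L[ℂ] E) →L[ℂ] (E →L[ℂ] E))
    (hL : ∀ x y : E, ∃ x' y' : E, L (rankOne A x y) = rankOne A x' y') {K : E →L[ℂ] E}
    (hK : K ∈ compactOperators A E) : L K ∈ compactOperators A E := by
  have h : compactOperators A E ≤
      (compactOperators A E).comap (L : (E →L[ℂ] E) →ₗ[ℂ] (E →L[ℂ] E)) := by
    refine Submodule.topologicalClosure_minimal _ (Submodule.span_le.mpr ?_) ?_
    · rintro _ ⟨x, y, rfl⟩
      exact Submodule.le_topologicalClosure _ (Submodule.subset_span (hL x y))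
    · exact (Submodule.isClosed_topologicalClosure _).preimage L.continuous
  exact h hK

theorem comp_mem_compactOperators {G K : E →L[ℂ] E} (hG : IsAdjointable A G)
    (hK : K ∈ compactOperators A E) : G.comp K ∈ compactOperators A E := by
  obtain ⟨S, hS⟩ := hG
  refine map_mem_compactOperators (ContinuousLinearMap.compL ℂ E E E G) (fun x y => ?_) hK
  -- `G θ_{x,y} = θ_{Gx,y}`, by `A`-linearity of `G`.
  refine ⟨G x, y, ?_⟩
  ext z
  simp [IsAdjointPair.map_smul hS]

theorem mem_compactOperators_comp {G K : E →L[ℂ] E} (hG : IsAdjointable A G)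
    (hK : K ∈ compactOperators A E) : K.comp G ∈ compactOperators A E := by
  obtain ⟨S, hS⟩ := hG
  refine map_mem_compactOperators ((ContinuousLinearMap.compL ℂ E E E).flip G) (fun x y => ?_) hK
  -- `θ_{x,y} G = θ_{x,G*y}`.
  refine ⟨x, S y, ?_⟩
  ext z
  simp [IsAdjointPair.symm hS y z]

/-! ### Graphs of `t + K` and of its adjoint. -/

theorem mem_graph_vadd (K : E →L[ℂ] E) (t : E →ₗ.[ℂ] E) (x y : E) :
    (x, y) ∈ ((K : E →ₗ[ℂ] E) +ᵥ t).graph ↔ (x, y - K x) ∈ t.graph := by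
  simp only [LinearPMap.mem_graph_iff]
  constructor
  · rintro ⟨u, rfl, rfl⟩
    exact ⟨u, rfl, by simp [LinearPMap.vadd_apply]⟩
  · rintro ⟨u, rfl, hu⟩
    exact ⟨u, rfl, by simp only [LinearPMap.vadd_apply, hu]; simp⟩

theorem mem_adjointGraph_vadd {K S : E →L[ℂ] E} (h : IsAdjointPair A K S) (t : E →ₗ.[ℂ] E)
    (x y : E) :
    (x, y) ∈ adjointGraph A ((K : E →ₗ[ℂ] E) +ᵥ t) ↔ (x, y - S x) ∈ adjointGraph A t := by
  refine forall_congr' fun u => ?_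
  simp only [LinearPMap.vadd_apply, CStarModule.inner_add_left, CStarModule.inner_sub_right,
    eq_sub_iff_add_eq', ContinuousLinearMap.coe_coe]
  exact Eq.congr_left (congrArg (· + _) (h _ _))

theorem isClosed_vadd (K : E →L[ℂ] E) {t : E →ₗ.[ℂ] E} (ht : t.IsClosed) :
    ((K : E →ₗ[ℂ] E) +ᵥ t).IsClosed := by
  have : (((K : E →ₗ[ℂ] E) +ᵥ t).graph : Set (E × E)) =
      (fun p : E × E => (p.1, p.2 - K p.1)) ⁻¹' t.graph := by
    ext ⟨x, y⟩
    exact mem_graph_vadd K t x y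
  rw [LinearPMap.IsClosed, this]
  exact ht.preimage (by fun_prop)

theorem isClosed_adjointGraph (t : E →ₗ.[ℂ] E) :
    IsClosed (adjointGraph A t : Set (E × E)) := by
  have : (adjointGraph A t : Set (E × E)) =
      ⋂ x : t.domain, {p | inner A (t x) p.1 = inner A (x : E) p.2} := by
    ext p
    simp [adjointGraph]
  rw [this]
  refine isClosed_iInter fun x => isClosed_eq ?_ ?_
  · exact (CStarModule.continuous_inner (A := A) (E := E)).comp
      (f := fun p : E × E => (t x, p.1)) (by fun_prop)
  · exact (CStarModule.continuous_inner (A := A) (E := E)).comp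
      (f := fun p : E × E => ((x : E), p.2)) (by fun_prop)

theorem mem_adjointGraph_iff {t : E →ₗ.[ℂ] E} {y z : E} :
    (y, z) ∈ adjointGraph A t ↔ ∀ x p, (x, p) ∈ t.graph → inner A p y = inner A x z := by
  constructor
  · rintro h x p hp
    obtain ⟨u, rfl, rfl⟩ := t.mem_graph_iff.mp hp
    exact h u
  · exact fun h u => h _ _ (t.mem_graph u)

theorem mem_domain_adjoint {t : E →ₗ.[ℂ] E} {y : E} :
    y ∈ (adjoint A t).domain ↔ ∃ z, (y, z) ∈ adjointGraph A t := by
  simp [adjoint, Submodule.toLinearPMap_domain]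

/-! ### Regularity as surjectivity of the operator matrix on `graph t × graph t*`. -/

variable (A) in
/-- The submodule `graph t × graph t*` of `E⁴`. -/
def graphPair (t : E →ₗ.[ℂ] E) : Submodule ℂ ((E × E) × (E × E)) :=
  t.graph.prod (adjointGraph A t)

theorem mem_graphPair {t : E →ₗ.[ℂ] E} {x p y z : E} :
    ((x, p), (y, z)) ∈ graphPair A t ↔ (x, p) ∈ t.graph ∧ (y, z) ∈ adjointGraph A t :=
  Submodule.mem_prod

theorem isClosed_graphPair {t : E →ₗ.[ℂ] E} (ht : t.IsClosed) :
    IsClosed (graphPair A t : Set ((E × E) × (E × E))) :=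
  ht.prod (isClosed_adjointGraph t)

variable (E) in
/-- The map `((x, p), (y, z)) ↦ (x + z, p - y)`. On `graphPair A t` it is the operator matrix with
rows `(1, t*)` and `(t, -1)`. -/
noncomputable def sumDiff : ((E × E) × (E × E)) →L[ℂ] E × E :=
  ((ContinuousLinearMap.fst ℂ E E).comp (ContinuousLinearMap.fst ℂ (E × E) (E × E)) +
    (ContinuousLinearMap.snd ℂ E E).comp (ContinuousLinearMap.snd ℂ (E × E) (E × E))).prod
  ((ContinuousLinearMap.snd ℂ E E).comp (ContinuousLinearMap.fst ℂ (E × E) (E × E)) -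
    (ContinuousLinearMap.fst ℂ E E).comp (ContinuousLinearMap.snd ℂ (E × E) (E × E)))

@[simp]
theorem sumDiff_apply (x p y z : E) : sumDiff E ((x, p), (y, z)) = (x + z, p - y) := rfl

-- The product carries the sup norm, so `√2` would suffice; `2` avoids the root.
variable (A) in
theorem norm_le_of_inner_self_le {x u v : E}
    (h : inner A x x ≤ inner A u u + inner A v v) : ‖x‖ ≤ 2 * ‖(u, v)‖ := by
  have h1 : ‖x‖ ^ 2 ≤ ‖u‖ ^ 2 + ‖v‖ ^ 2 := by
    rw [CStarModule.norm_sq_eq (A := A), CStarModule.norm_sq_eq (A := A) (x := u),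
      CStarModule.norm_sq_eq (A := A) (x := v)]
    exact (CStarAlgebra.norm_le_norm_of_nonneg_of_le CStarModule.inner_self_nonneg h).trans
      (norm_add_le _ _)
  have hu : ‖u‖ ^ 2 ≤ ‖(u, v)‖ ^ 2 := by gcongr; exact norm_fst_le (u, v)
  have hv : ‖v‖ ^ 2 ≤ ‖(u, v)‖ ^ 2 := by gcongr; exact norm_snd_le (u, v)
  refine le_of_sq_le_sq ?_ (by positivity)
  rw [mul_pow]
  linarith [sq_nonneg ‖(u, v)‖]

/-- With `p = t x` and `z = t* y`, the relation `⟪p, y⟫ = ⟪x, z⟫` cancels the cross terms, so the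
squares of `x + z` and `p - y` add up to those of `x`, `p`, `y`, `z`. Each of the four is positive,
hence dominated by the sum. -/
theorem norm_le_norm_sumDiff {t : E →ₗ.[ℂ] E} {m : (E × E) × (E × E)} (hm : m ∈ graphPair A t) :
    ‖m‖ ≤ 2 * ‖sumDiff E m‖ := by
  obtain ⟨⟨x, p⟩, ⟨y, z⟩⟩ := m
  obtain ⟨h1, h2⟩ := mem_graphPair.mp hm
  have h3 : inner A p y = inner A x z := mem_adjointGraph_iff.mp h2 x p h1
  have h4 : inner A y p = inner A z x := by
    rw [← CStarModule.star_inner (A := A) p y, h3, CStarModule.star_inner]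
  have key : inner A (x + z) (x + z) + inner A (p - y) (p - y) =
      inner A x x + inner A p p + inner A y y + inner A z z := by
    simp only [CStarModule.inner_add_left, CStarModule.inner_add_right,
      CStarModule.inner_sub_left, CStarModule.inner_sub_right, h3, h4]
    abel
  have hx : (0 : A) ≤ inner A x x := CStarModule.inner_self_nonneg
  have hp : (0 : A) ≤ inner A p p := CStarModule.inner_self_nonneg
  have hy : (0 : A) ≤ inner A y y := CStarModule.inner_self_nonneg
  have hz : (0 : A) ≤ inner A z z := CStarModule.inner_self_nonneg
  rw [sumDiff_apply]
  refine norm_prod_le_iff.mpr ⟨norm_prod_le_iff.mpr ⟨?_, ?_⟩, norm_prod_le_iff.mpr ⟨?_, ?_⟩⟩ <;>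
    refine norm_le_of_inner_self_le A ?_ <;> rw [key]
  · rw [add_assoc, add_assoc]
    exact le_add_of_nonneg_right (add_nonneg hp (add_nonneg hy hz))
  · rw [add_assoc]
    exact (le_add_of_nonneg_left hx).trans (le_add_of_nonneg_right (add_nonneg hy hz))
  · exact (le_add_of_nonneg_left (add_nonneg hx hp)).trans (le_add_of_nonneg_right hz)
  · exact le_add_of_nonneg_left (add_nonneg (add_nonneg hx hp) hy)

variable (A) in
/-- The graphs of `t` and of `t*` span `E × E`, in the sense that every pair `(u, v)` has the form
`(x + t* y, t x - y)`. -/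
def GraphComplemented (t : E →ₗ.[ℂ] E) : Prop :=
  (graphPair A t).map (sumDiff E : (E × E) × (E × E) →ₗ[ℂ] E × E) = ⊤

theorem graphComplemented_iff {t : E →ₗ.[ℂ] E} :
    GraphComplemented A t ↔ ∀ w, ∃ m ∈ graphPair A t, sumDiff E m = w := by
  simp [GraphComplemented, Submodule.eq_top_iff']

theorem mem_range_id_vadd_comp_adjoint {t : E →ₗ.[ℂ] E} (ht : Dense (t.domain : Set E)) {u : E} :
    u ∈ Set.range ((LinearMap.id : E →ₗ[ℂ] E) +ᵥ comp (adjoint A t) t) ↔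
      ∃ x y z, (x, y) ∈ t.graph ∧ (y, z) ∈ adjointGraph A t ∧ x + z = u := by
  rw [← graph_adjoint A t ht]
  constructor
  · rintro ⟨x, rfl⟩
    obtain ⟨y, h1, h2⟩ := (mem_graph_comp _ _ _).mp ((comp (adjoint A t) t).mem_graph x)
    exact ⟨_, y, _, h1, h2, rfl⟩
  · rintro ⟨x, y, z, h1, h2, rfl⟩
    obtain ⟨w, rfl, rfl⟩ :=
      (LinearPMap.mem_graph_iff _).mp ((mem_graph_comp (adjoint A t) t (x, z)).mpr ⟨y, h1, h2⟩)
    exact ⟨w, rfl⟩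

theorem IsRegular.graphComplemented [CompleteSpace E] {t : E →ₗ.[ℂ] E} (ht : IsRegular A t) :
    GraphComplemented A t := by
  set R := (graphPair A t).map (sumDiff E : (E × E) × (E × E) →ₗ[ℂ] E × E)
  have hcl : IsClosed (R : Set (E × E)) :=
    isClosed_map_of_bound _ (isClosed_graphPair ht.isClosed) _ 2
      fun m hm => by simpa using norm_le_norm_sumDiff hm
  have hmem {x p y z : E} (h1 : (x, p) ∈ t.graph) (h2 : (y, z) ∈ adjointGraph A t) :
      (x + z, p - y) ∈ R := ⟨((x, p), (y, z)), mem_graphPair.mpr ⟨h1, h2⟩, rfl⟩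
  -- Taking `y = t x` produces `(x + t* t x, 0)`; density and closedness give all `(u, 0)`.
  have hleft (u : E) : (u, (0 : E)) ∈ R := by
    refine ht.dense_range.induction (P := fun u => (u, (0 : E)) ∈ R) (fun u hu => ?_)
      (hcl.preimage (f := fun u : E => (u, (0 : E))) (by fun_prop)) u
    obtain ⟨x, y, z, h1, h2, rfl⟩ := (mem_range_id_vadd_comp_adjoint ht.dense_domain).mp hu
    simpa using hmem h1 h2
  have hright (v : E) : ((0 : E), v) ∈ R := by
    refine ht.dense_adjoint_domain.induction (P := fun v => ((0 : E), v) ∈ R) (fun v hv => ?_)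
      (hcl.preimage (f := fun v : E => ((0 : E), v)) (by fun_prop)) v
    obtain ⟨z, hz⟩ := mem_domain_adjoint.mp hv
    -- The pair `x = 0`, `y = -v` produces `(-t* v, v)`; its first entry is removed by `hleft`.
    have h1 := hmem t.graph.zero_mem ((adjointGraph A t).neg_mem hz)
    have h2 := R.add_mem h1 (hleft z)
    simpa using h2
  refine Submodule.eq_top_iff'.mpr fun ⟨u, v⟩ => ?_
  have h := R.add_mem (hleft u) (hright v)
  rwa [Prod.mk_add_mk, add_zero, zero_add] at h

theorem GraphComplemented.dense_range {t : E →ₗ.[ℂ] E} (h : GraphComplemented A t)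
    (ht : Dense (t.domain : Set E)) :
    Dense (Set.range ((LinearMap.id : E →ₗ[ℂ] E) +ᵥ comp (adjoint A t) t)) := by
  convert dense_univ
  refine Set.eq_univ_of_forall fun u => (mem_range_id_vadd_comp_adjoint ht).mpr ?_
  -- A zero second entry forces `y = t x`, so `u = x + t* t x`: the range is all of `E`.
  obtain ⟨⟨⟨x, p⟩, ⟨y, z⟩⟩, hm, hu⟩ := graphComplemented_iff.mp h (u, 0)
  obtain ⟨h1, h2⟩ := mem_graphPair.mp hm
  rw [sumDiff_apply, Prod.mk.injEq, sub_eq_zero] at hu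
  obtain ⟨h3, rfl⟩ := hu
  exact ⟨x, p, z, h1, h2, h3⟩

/-- A bounded right inverse of `sumDiff E` with values in `graphPair A t`. -/
theorem GraphComplemented.exists_rightInverse {t : E →ₗ.[ℂ] E} (h : GraphComplemented A t) :
    ∃ R : E × E →L[ℂ] (E × E) × (E × E), ‖R‖ ≤ 2 ∧
      ∀ w, R w ∈ graphPair A t ∧ sumDiff E (R w) = w := by
  let f : graphPair A t →ₗ[ℂ] E × E :=
    (sumDiff E : (E × E) × (E × E) →ₗ[ℂ] E × E).domRestrict (graphPair A t)
  have hf : Function.Bijective f := by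
    refine ⟨(injective_iff_map_eq_zero f).mpr fun m hm => ?_, fun w => ?_⟩
    · have hm' : sumDiff E (m : (E × E) × (E × E)) = 0 := hm
      have := norm_le_norm_sumDiff m.2
      rw [hm', norm_zero, mul_zero, norm_le_zero_iff] at this
      exact Subtype.ext this
    · obtain ⟨m, hm, hw⟩ := graphComplemented_iff.mp h w
      exact ⟨⟨m, hm⟩, hw⟩
  let e := LinearEquiv.ofBijective f hf
  have he (w : E × E) : sumDiff E (e.symm w : (E × E) × (E × E)) = w := e.apply_symm_apply w
  refine ⟨LinearMap.mkContinuous ((graphPair A t).subtype ∘ₗ e.symm.toLinearMap) 2 fun w => ?_,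
    LinearMap.mkContinuous_norm_le _ zero_le_two _, fun w => ⟨(e.symm w).2, he w⟩⟩
  have := norm_le_norm_sumDiff (e.symm w).2
  rwa [he] at this

/-! ### Bounded adjointable perturbations. -/

theorem GraphComplemented.vadd_of_norm_lt [CompleteSpace E] {t : E →ₗ.[ℂ] E}
    (h : GraphComplemented A t) {K S : E →L[ℂ] E} (hKS : IsAdjointPair A K S)
    (hK : ‖K‖ ≤ 1 / 4) : GraphComplemented A ((K : E →ₗ[ℂ] E) +ᵥ t) := by
  obtain ⟨R, hR, hRmem⟩ := h.exists_rightInverse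
  -- `B` is the change of the matrix caused by `K`: `((x, p), (y, z)) ↦ (K* y, K x)`. As `‖B‖ ‖R‖ ≤
  -- 1/2`, the operator `1 + BR` is invertible.
  let B : (E × E) × (E × E) →L[ℂ] E × E :=
    (S.comp ((ContinuousLinearMap.fst ℂ E E).comp
      (ContinuousLinearMap.snd ℂ (E × E) (E × E)))).prod
    (K.comp ((ContinuousLinearMap.fst ℂ E E).comp
      (ContinuousLinearMap.fst ℂ (E × E) (E × E))))
  have hB : ‖B‖ ≤ 1 / 4 := by
    refine B.opNorm_le_bound (by norm_num) fun m => norm_prod_le_iff.mpr ⟨?_, ?_⟩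
    · refine (S.le_of_opNorm_le (hKS.norm_le.trans hK) _).trans ?_
      gcongr
      exact (norm_fst_le m.2).trans (norm_snd_le m)
    · refine (K.le_of_opNorm_le hK _).trans ?_
      gcongr
      exact (norm_fst_le m.1).trans (norm_fst_le m)
  have hBR : ‖-(B.comp R)‖ < 1 := by
    rw [norm_neg]
    calc _ ≤ ‖B‖ * ‖R‖ := B.opNorm_comp_le R
      _ ≤ 1 / 4 * 2 := by gcongr
      _ < 1 := by norm_num
  obtain ⟨C, hC⟩ := (isUnit_one_sub_of_norm_lt_one hBR).exists_right_inv
  refine graphComplemented_iff.mpr fun w => ?_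
  have hw : C w + B (R (C w)) = w := by simpa using congrArg (fun T => T w) hC
  obtain ⟨hmem, hv⟩ := hRmem (C w)
  obtain ⟨⟨⟨x, p⟩, ⟨y, z⟩⟩, hm⟩ : ∃ m, m = R (C w) := ⟨_, rfl⟩
  rw [← hm] at hmem hv hw
  obtain ⟨h1, h2⟩ := mem_graphPair.mp hmem
  -- The solution for `t` with right-hand side `C w`, moved to the graphs of `t + K` and its
  -- adjoint; the correction `B (R (C w))` completes `C w` to `w`.
  refine ⟨((x, p + K x), (y, z + S y)), mem_graphPair.mpr ⟨?_, ?_⟩, ?_⟩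
  · rwa [mem_graph_vadd, add_sub_cancel_right]
  · simpa [mem_adjointGraph_vadd hKS] using h2
  · rw [← hw, ← hv, sumDiff_apply, sumDiff_apply]
    change _ = (x + z, p - y) + (S y, K x)
    ext <;> simp <;> abel

/-- The threshold `1/4` does not depend on `t`, so the small step can be iterated: add `K / n`
successively `n` times, with `n > 4‖K‖`. -/
theorem GraphComplemented.vadd [CompleteSpace E] {t : E →ₗ.[ℂ] E}
    (h : GraphComplemented A t) {K S : E →L[ℂ] E} (hKS : IsAdjointPair A K S) :
    GraphComplemented A ((K : E →ₗ[ℂ] E) +ᵥ t) := by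
  obtain ⟨n, hn⟩ := exists_nat_gt (4 * ‖K‖)
  have hn0 : (0 : ℝ) < n := lt_of_le_of_lt (by positivity) hn
  set c : ℂ := (n : ℂ)⁻¹
  have hc : ‖c • K‖ ≤ 1 / 4 := by
    rw [norm_smul, norm_inv, Complex.norm_natCast, inv_mul_le_iff₀ hn0]
    linarith
  have step (j : ℕ) :
      GraphComplemented A (((j • (c • K) : E →L[ℂ] E) : E →ₗ[ℂ] E) +ᵥ t) := by
    induction j with
    | zero => simpa using h
    | succ j ih =>
      have := ih.vadd_of_norm_lt (hKS.smul c) hc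
      rwa [← add_vadd, ← ContinuousLinearMap.toLinearMap_add, ← succ_nsmul'] at this
  have hK : n • (c • K) = K := by
    rw [← Nat.cast_smul_eq_nsmul ℂ, smul_smul, mul_inv_cancel₀ (by exact_mod_cast hn0.ne'),
      one_smul]
  simpa only [hK] using step n

/-- A bounded adjointable perturbation of a regular operator is regular. -/
theorem IsRegular.vadd [CompleteSpace E] {t : E →ₗ.[ℂ] E} (ht : IsRegular A t) {K : E →L[ℂ] E}
    (hK : IsAdjointable A K) : IsRegular A ((K : E →ₗ[ℂ] E) +ᵥ t) := by
  obtain ⟨S, hS⟩ := hK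
  refine ⟨ht.smul_mem, fun a x => ?_, isClosed_vadd K ht.isClosed, ht.dense_domain, ?_,
    (ht.graphComplemented.vadd hS).dense_range ht.dense_domain⟩
  · rw [LinearPMap.vadd_apply, LinearPMap.vadd_apply, ht.map_smul a x]
    refine ext_inner_left A fun w => ?_
    simp [IsAdjointPair.map_smul hS, CStarModule.inner_op_smul_right, mul_add]
  · refine ht.dense_adjoint_domain.mono fun y hy => ?_
    obtain ⟨z, hz⟩ := mem_domain_adjoint.mp hy
    exact mem_domain_adjoint.mpr ⟨z + S y, by simpa [mem_adjointGraph_vadd hS] using hz⟩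

/-! ### Closures and compact perturbations of Fredholm operators. -/

theorem graph_toPMap_top (T : E →L[ℂ] E) (x y : E) :
    (x, y) ∈ ((T : E →ₗ[ℂ] E).toPMap ⊤).graph ↔ T x = y := by
  simp [LinearPMap.mem_graph_iff]

/-- The shear `(x, y) ↦ (x, y - K x)` is a homeomorphism, so it commutes with closure. -/
theorem topologicalClosure_graph_vadd (K : E →L[ℂ] E) (f : E →ₗ.[ℂ] E) (p : E × E) :
    p ∈ ((K : E →ₗ[ℂ] E) +ᵥ f).graph.topologicalClosure ↔
      (p.1, p.2 - K p.1) ∈ f.graph.topologicalClosure := by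
  let e : E × E ≃ₜ E × E :=
    { toFun := fun p => (p.1, p.2 - K p.1)
      invFun := fun p => (p.1, p.2 + K p.1)
      left_inv := fun p => by simp
      right_inv := fun p => by simp
      continuous_toFun := by fun_prop
      continuous_invFun := by fun_prop }
  have h : (((K : E →ₗ[ℂ] E) +ᵥ f).graph : Set (E × E)) = e ⁻¹' f.graph := by
    ext ⟨x, y⟩
    exact mem_graph_vadd K f x y
  rw [← SetLike.mem_coe, Submodule.topologicalClosure_coe, h, ← e.preimage_closure]
  rfl

theorem ClosureIsOneModCompact.vadd [CompleteSpace E] {f : E →ₗ.[ℂ] E}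
    (hf : ClosureIsOneModCompact A f) {K : E →L[ℂ] E} (hK : K ∈ compactOperators A E) :
    ClosureIsOneModCompact A ((K : E →ₗ[ℂ] E) +ᵥ f) := by
  obtain ⟨hcl, T, hT, hfT, hT1⟩ := hf
  -- The closure of `f + K` is `T + K`; this identity yields closability as well.
  have hgraph : ((K : E →ₗ[ℂ] E) +ᵥ f).graph.topologicalClosure =
      (((K + T : E →L[ℂ] E) : E →ₗ[ℂ] E).toPMap ⊤).graph := by
    ext ⟨x, y⟩
    rw [topologicalClosure_graph_vadd, hcl.graph_closure_eq_closure_graph, hfT,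
      graph_toPMap_top, graph_toPMap_top, eq_sub_iff_add_eq', add_apply]
  have hcl' : ((K : E →ₗ[ℂ] E) +ᵥ f).IsClosable := ⟨_, hgraph⟩
  refine ⟨hcl', K + T,
    (adjointableOperators A E).add_mem (isAdjointable_of_mem_compactOperators hK) hT,
    LinearPMap.eq_of_eq_graph ?_, ?_⟩
  · rw [← hcl'.graph_closure_eq_closure_graph, hgraph]
  · rw [add_sub_assoc]
    exact add_mem hK hT1

theorem comp_toPMap_vadd (G K : E →L[ℂ] E) (t : E →ₗ.[ℂ] E) :
    comp ((G : E →ₗ[ℂ] E).toPMap ⊤) ((K : E →ₗ[ℂ] E) +ᵥ t) =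
      ((G.comp K : E →L[ℂ] E) : E →ₗ[ℂ] E) +ᵥ comp ((G : E →ₗ[ℂ] E).toPMap ⊤) t := by
  refine LinearPMap.eq_of_eq_graph ?_
  ext ⟨x, y⟩
  simp only [mem_graph_vadd, mem_graph_comp, graph_toPMap_top]
  constructor
  · rintro ⟨w, h1, rfl⟩
    exact ⟨_, h1, by simp⟩
  · rintro ⟨w, h1, h2⟩
    exact ⟨w + K x, by simpa using h1, by simp [h2]⟩

theorem vadd_comp_toPMap (G K : E →L[ℂ] E) (t : E →ₗ.[ℂ] E) :
    comp ((K : E →ₗ[ℂ] E) +ᵥ t) ((G : E →ₗ[ℂ] E).toPMap ⊤) =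
      ((K.comp G : E →L[ℂ] E) : E →ₗ[ℂ] E) +ᵥ comp t ((G : E →ₗ[ℂ] E).toPMap ⊤) := by
  refine LinearPMap.eq_of_eq_graph ?_
  ext ⟨x, y⟩
  simp only [mem_graph_vadd, mem_graph_comp, graph_toPMap_top]
  simp

/-- A compact perturbation of a Fredholm operator is Fredholm. -/
theorem IsFredholm.vadd [CompleteSpace E] {t : E →ₗ.[ℂ] E} (ht : IsFredholm A t)
    {K : E →L[ℂ] E} (hK : K ∈ compactOperators A E) :
    IsFredholm A ((K : E →ₗ[ℂ] E) +ᵥ t) := by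
  obtain ⟨⟨G, hG, hl⟩, ⟨G', hG', hr⟩⟩ := ht
  refine ⟨⟨G, hG, ?_⟩, ⟨G', hG', ?_⟩⟩
  · rw [comp_toPMap_vadd]
    exact hl.vadd (comp_mem_compactOperators hG hK)
  · rw [vadd_comp_toPMap]
    exact hr.vadd (mem_compactOperators_comp hG' hK)

end

end HilbertModule

theorem mainTheorem7 {A E : Type*} [NonUnitalCStarAlgebra A] [PartialOrder A] [StarOrderedRing A]
    [NormedAddCommGroup E] [NormedSpace ℂ E] [CompleteSpace E] [SMul A E] [CStarModule A E]
    (t : E →ₗ.[ℂ] E) (ht : HilbertModule.IsRegular A t) (hF : HilbertModule.IsFredholm A t)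
    (K : E →L[ℂ] E) (hK : K ∈ HilbertModule.compactOperators A E) :
    HilbertModule.IsRegular A ((K : E →ₗ[ℂ] E) +ᵥ t) ∧
      HilbertModule.IsFredholm A ((K : E →ₗ[ℂ] E) +ᵥ t) :=
  ⟨ht.vadd (HilbertModule.isAdjointable_of_mem_compactOperators hK), hF.vadd hK⟩
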